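/- Let $A$ be an infinite set of atoms. Formulae are built from atoms and $\bot$ by $\wedge,\vee,\supset$. An atomic rule has the form $((P_1\Rightarrow q_1),\dots,(P_n\Rightarrow q_n))\Rightarrow r$ with $n\ge 0$, each $P_i$ a finite set of atoms and $q_i,r$ atoms; a base is a set of atomic rules (automatically countable if $A$ is countable). For a base $\mathcal B$, the relation $P\vdash_{\mathcal B}p$ between sets of atoms and atoms is generated by: $P\vdash_{\mathcal B}p$ if $p\in P$; and $P\vdash_{\mathcal B}r$ if a rule as above is in $\mathcal B$ and $P\cup P_i\vdash_{\mathcal B}q_i$ for all $i$. **Base-extension validity.** $\Vdash_{\mathcal B}\phi$ is defined by recursion on $\phi$: $\Vdash_{\mathcal B}p$ iff $\emptyset\vdash_{\mathcal B}p$; $\Vdash_{\mathcal B}\bot$ iff $\Vdash_{\mathcal B}p$ for all atoms $p$; $\Vdash_{\mathcal B}\phi\wedge\psi$ iff $\Vdash_{\mathcal B}\phi$ and $\Vdash_{\mathcal B}\psi$; $\Vdash_{\mathcal B}\phi\supset\psi$ iff $\phi\Vdash_{\mathcal B}\psi$; $\Vdash_{\mathcal B}\phi\vee\psi$ iff for every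 atom $p$ and every base $\mathcal C\supseteq\mathcal B$, $\phi\Vdash_{\mathcal C}p$ and $\psi\Vdash_{\mathcal C}p$ imply $\Vdash_{\mathcal C}p$; here $\theta\Vdash_{\mathcal B}\chi$ means that for every base $\mathcal C\supseteq\mathcal B$, $\Vdash_{\mathcal C}\theta$ implies $\Vdash_{\mathcal C}\chi$. For a finite set $\Gamma$ of formulae, $\Gamma\Vdash\phi$ means that for every base $\mathcal B$, if $\Vdash_{\mathcal B}\psi$ for all $\psi\in\Gamma$, then $\Vdash_{\mathcal B}\phi$. **Categorical validity.** A context $(X:P)$ is a finite list $x_1:p_1,\dots,x_m:p_m$ of variables with atoms. Derivation terms $(X:P)\vdash_{\mathcal B}\Phi:p$ are the variables $x_i:p_i$ and the terms $\Phi_{\mathcal R}(\Phi_1,\dots,\Phi_n):r$ for rules $\mathcal R\in\mathcal B$ as above, where $(X:P),(X_i:P_i)\vdash_{\mathcal B}\Phi_i:q_i$ and the variables $X_i$ (one for each element of $P_i$) become bound; terms are taken up to renaming of variables. Let $\mathcal W$ be the category whose objects are pairs $(\mathcal B,(X:P))$ and whose morphisms $(\mathcal B,(X:P))\to(\mathcal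 C,(Y:Q))$ exist only if $\mathcal C\subseteq\mathcal B$ and consist of a derivation $(X:P)\vdash_{\mathcal B}\Phi_j:q_j$ for each variable $y_j:q_j$ of $(Y:Q)$; identities are the variables, and composition is substitution. Write $h^w=\mathcal W(-,w)$. Define presheaves $⟦\phi⟧:\mathcal W^{op}\to\mathbf{Set}$ by: $⟦p⟧(\mathcal B,(X:P))$ is the set of derivations $(X:P)\vdash_{\mathcal B}\Phi:p$, on which morphisms act by substitution; $⟦\phi\wedge\psi⟧=⟦\phi⟧\times⟦\psi⟧$; $⟦\phi\supset\psi⟧=⟦\phi⟧\supset⟦\psi⟧$, where $(F\supset G)(w)=\mathrm{Nat}(h^w\times F,G)$; $⟦\phi\vee\psi⟧=\forall_p\big((⟦\phi⟧\supset⟦p⟧)\supset((⟦\psi⟧\supset⟦p⟧)\supset⟦p⟧)\big)$ and $⟦\bot⟧=\forall_p⟦p⟧$, where for a family $(K_p)_{p\in A}$ of presheaves $(\forall_pK_p)(w)=\prod_{p\in A}\mathrm{Nat}(h^w,K_p)$. For a finite set $\Gamma$ put $⟦\Gamma⟧=\prod_{\psi\in\Gamma}⟦\psi⟧$, and let $\Gamma\models\phi$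 mean that there is a natural transformation $⟦\Gamma⟧\to⟦\phi⟧$. **Proposition (Equivalence).** For every finite set $\Gamma$ of formulae and every formula $\phi$, $\Gamma\Vdash\phi$ if and only if $\Gamma\models\phi$. -/

import Mathlib

universe u

namespace BaseExt

noncomputable section

/-- Formulae of intuitionistic propositional logic over a set of atoms. -/
inductive Formula (Atom : Type u) : Type u
  | atom : Atom → Formula Atom
  | bot : Formula Atom
  | and : Formula Atom → Formula Atom → Formula Atom
  | or : Formula Atom → Formula Atom → Formula Atom
  | imp : Formula Atom → Formula Atom → Formula Atom

/-- An atomic rule `((P₁ ⇒ q₁), …, (Pₙ ⇒ qₙ)) ⇒ r`: the list of its premises `(Pᵢ, qᵢ)`, each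
`Pᵢ` a finite set of atoms (the discharged hypotheses), and its conclusion `r`. -/
structure AtomicRule (Atom : Type u) : Type u where
  prems : List (Finset Atom × Atom)
  concl : Atom

/-- A base is a set of atomic rules, ordered by inclusion. -/
abbrev Base (Atom : Type u) : Type u := Set (AtomicRule Atom)

/-- Over a countable set of atoms every base is automatically countable. -/
theorem Base.countable {Atom : Type u} [Countable Atom] (B : Base Atom) :
    Set.Countable B := by
  have hinj : Function.Injective
      (fun R : AtomicRule Atom => (R.prems, R.concl)) := by
    rintro ⟨a, b⟩ ⟨c, d⟩ h
    simpa using h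
  have : Countable (AtomicRule Atom) := hinj.countable
  exact Set.to_countable B

/-- Consequence for atoms with respect to a base, `P ⊢_B p`. -/
inductive Entails {Atom : Type u} (B : Base Atom) : Set Atom → Atom → Prop
  | ref {P : Set Atom} {p : Atom} : p ∈ P → Entails B P p
  | app {P : Set Atom} (R : AtomicRule Atom) : R ∈ B →
      (∀ i : Fin R.prems.length,
        Entails B (P ∪ ((R.prems.get i).1 : Set Atom)) (R.prems.get i).2) →
      Entails B P R.concl

/-- Validity in a base, `⊩_B φ`; hypothetical validity `θ ⊩_B χ`, which occurs in the clauses for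
implication and disjunction, is unfolded to: for every `C ⊇ B`, if `⊩_C θ` then `⊩_C χ`. -/
def ValidIn {Atom : Type u} : Formula Atom → Base Atom → Prop
  | .atom p, B => Entails B ∅ p
  | .bot, B => ∀ p : Atom, Entails B ∅ p
  | .and φ ψ, B => ValidIn φ B ∧ ValidIn ψ B
  | .or φ ψ, B => ∀ (p : Atom) (C : Base Atom), B ⊆ C →
      (∀ D : Base Atom, C ⊆ D → ValidIn φ D → Entails D ∅ p) →
      (∀ D : Base Atom, C ⊆ D → ValidIn ψ D → Entails D ∅ p) → Entails C ∅ p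
  | .imp φ ψ, B => ∀ C : Base Atom, B ⊆ C → ValidIn φ C → ValidIn ψ C

/-- Base-extension validity `Γ ⊩ φ`. -/
def Valid {Atom : Type u} (Γ : Finset (Formula Atom)) (φ : Formula Atom) : Prop :=
  ∀ B : Base Atom, (∀ ψ ∈ Γ, ValidIn ψ B) → ValidIn φ B

/-- A context `x₁ : p₁, …, xₘ : pₘ`, with variables represented by their positions. The same atom
may be the type of several variables. -/
abbrev Ctx (Atom : Type u) : Type u := List Atom

/-- The variables of type `p` in a context. -/
inductive Var {Atom : Type u} : Ctx Atom → Atom → Type u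
  | zero {p : Atom} {X : Ctx Atom} : Var (p :: X) p
  | succ {p q : Atom} {X : Ctx Atom} : Var X p → Var (q :: X) p

/-- Derivation terms `(X : P) ⊢_B Φ : p`: variables, and rule applications
`Φ_R(Φ₁, …, Φₙ)`, where `Φᵢ` lives in the context extended by one (bound) variable for each atom
in the set `Pᵢ`. -/
inductive Der {Atom : Type u} (B : Base Atom) : Ctx Atom → Atom → Type u
  | var {X : Ctx Atom} {p : Atom} : Var X p → Der B X p
  | app {X : Ctx Atom} (R : AtomicRule Atom) : R ∈ B →
      (∀ i : Fin R.prems.length,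
        Der B ((R.prems.get i).1.toList ++ X) (R.prems.get i).2) →
      Der B X R.concl

/-- Renamings of variables. -/
abbrev Ren {Atom : Type u} (X Y : Ctx Atom) : Type u := ∀ p : Atom, Var X p → Var Y p

/-- Simultaneous substitutions: a derivation from `Y` in `B` for every variable of `X`. -/
abbrev Subn {Atom : Type u} (B : Base Atom) (X Y : Ctx Atom) : Type u :=
  ∀ p : Atom, Var X p → Der B Y p

namespace Ren

variable {Atom : Type u} {X Y Z : Ctx Atom}

/-- Extension of a renaming by one variable. -/
def lift₁ (q : Atom) (ρ : Ren X Y) : Ren (q :: X) (q :: Y)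
  | _, .zero => .zero
  | _, .succ x => .succ (ρ _ x)

/-- Extension of a renaming by a list of variables. -/
def lift : (L : List Atom) → Ren X Y → Ren (L ++ X) (L ++ Y)
  | [], ρ => ρ
  | q :: L, ρ => lift₁ q (lift L ρ)

theorem lift_comp (L : List Atom) (ρ : Ren X Y) (τ : Ren Y Z) (p : Atom) (x : Var (L ++ X) p) :
    lift L τ p (lift L ρ p x) = lift L (fun p x => τ p (ρ p x)) p x := by
  induction L with
  | nil => rfl
  | cons q L ih =>
    cases x with
    | zero => rfl
    | succ x => exact congrArg Var.succ (ih x)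

end Ren

namespace Der

variable {Atom : Type u} {B C : Base Atom}

/-- Renaming the free variables of a derivation. -/
def rename {X : Ctx Atom} {p : Atom} (Φ : Der B X p) : ∀ {Y : Ctx Atom}, Ren X Y → Der B Y p :=
  match Φ with
  | .var x => fun ρ => .var (ρ _ x)
  | .app R h Φs => fun ρ => .app R h fun i => (Φs i).rename (ρ.lift _)

/-- A derivation in a base is also a derivation in every larger base. -/
def mono (hBC : B ⊆ C) {X : Ctx Atom} {p : Atom} : Der B X p → Der C X p
  | .var x => .var x
  | .app R h Φs => .app R (hBC h) fun i => (Φs i).mono hBC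

end Der

namespace Subn

variable {Atom : Type u} {B C : Base Atom} {X Y Z : Ctx Atom}

/-- Extension of a substitution by one variable. -/
def lift₁ (q : Atom) (σ : Subn B X Y) : Subn B (q :: X) (q :: Y)
  | _, .zero => .var .zero
  | _, .succ x => (σ _ x).rename fun _ y => .succ y

/-- Extension of a substitution by a list of variables. -/
def lift : (L : List Atom) → Subn B X Y → Subn B (L ++ X) (L ++ Y)
  | [], σ => σ
  | q :: L, σ => lift₁ q (lift L σ)

end Subn

namespace Der

variable {Atom : Type u} {B C D : Base Atom}

/-- The capture-avoiding simultaneous substitution `Φ[Φ₁/x₁, …, Φₘ/xₘ]`. -/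
def subst {X : Ctx Atom} {p : Atom} (Φ : Der B X p) : ∀ {Y : Ctx Atom}, Subn B X Y → Der B Y p :=
  match Φ with
  | .var x => fun σ => σ _ x
  | .app R h Φs => fun σ => .app R h fun i => (Φs i).subst (Subn.lift _ σ)

theorem rename_rename {X : Ctx Atom} {p : Atom} (Φ : Der B X p) :
    ∀ {Y Z : Ctx Atom} (ρ : Ren X Y) (τ : Ren Y Z),
      (Φ.rename ρ).rename τ = Φ.rename fun p x => τ p (ρ p x) := by
  induction Φ with
  | var x => intros; rfl
  | app R h Φs ih =>
    intro Y Z ρ τ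
    simp only [rename, ih]
    congr 1; funext i; congr 1; funext p x
    exact Ren.lift_comp _ ρ τ p x

theorem lift_rename (L : List Atom) {X Y Z : Ctx Atom} (ρ : Ren X Y) (σ : Subn B Y Z) (p : Atom)
    (x : Var (L ++ X) p) :
    Subn.lift L σ p (Ren.lift L ρ p x) = Subn.lift L (fun p x => σ p (ρ p x)) p x := by
  induction L with
  | nil => rfl
  | cons q L ih =>
    cases x with
    | zero => rfl
    | succ x => exact congrArg (fun Ψ => Der.rename Ψ _) (ih x)

theorem subst_rename {X : Ctx Atom} {p : Atom} (Φ : Der B X p) :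
    ∀ {Y Z : Ctx Atom} (ρ : Ren X Y) (σ : Subn B Y Z),
      (Φ.rename ρ).subst σ = Φ.subst fun p x => σ p (ρ p x) := by
  induction Φ with
  | var x => intros; rfl
  | app R h Φs ih =>
    intro Y Z ρ σ
    simp only [rename, subst, ih]
    congr 1; funext i; congr 1; funext p x
    exact lift_rename _ ρ σ p x

theorem rename_lift (L : List Atom) {X Y Z : Ctx Atom} (σ : Subn B X Y) (ρ : Ren Y Z) (p : Atom)
    (x : Var (L ++ X) p) :
    (Subn.lift L σ p x).rename (Ren.lift L ρ) = Subn.lift L (fun p x => (σ p x).rename ρ) p x := by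
  induction L with
  | nil => rfl
  | cons q L ih =>
    cases x with
    | zero => rfl
    | succ x =>
      change Der.rename (Der.rename _ _) _ = Der.rename _ _
      rw [rename_rename, ← ih, rename_rename]
      rfl

theorem rename_subst {X : Ctx Atom} {p : Atom} (Φ : Der B X p) :
    ∀ {Y Z : Ctx Atom} (σ : Subn B X Y) (ρ : Ren Y Z),
      (Φ.subst σ).rename ρ = Φ.subst fun p x => (σ p x).rename ρ := by
  induction Φ with
  | var x => intros; rfl
  | app R h Φs ih =>
    intro Y Z σ ρ
    simp only [rename, subst, ih]
    congr 1; funext i; congr 1; funext p x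
    exact rename_lift _ σ ρ p x

theorem subst_lift (L : List Atom) {X Y Z : Ctx Atom} (σ : Subn B X Y) (τ : Subn B Y Z) (p : Atom)
    (x : Var (L ++ X) p) :
    (Subn.lift L σ p x).subst (Subn.lift L τ) = Subn.lift L (fun p x => (σ p x).subst τ) p x := by
  induction L with
  | nil => rfl
  | cons q L ih =>
    cases x with
    | zero => rfl
    | succ x =>
      change Der.subst (Der.rename _ _) _ = Der.rename _ _
      rw [subst_rename, ← ih, rename_subst]
      rfl

theorem subst_subst {X : Ctx Atom} {p : Atom} (Φ : Der B X p) :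
    ∀ {Y Z : Ctx Atom} (σ : Subn B X Y) (τ : Subn B Y Z),
      (Φ.subst σ).subst τ = Φ.subst fun p x => (σ p x).subst τ := by
  induction Φ with
  | var x => intros; rfl
  | app R h Φs ih =>
    intro Y Z σ τ
    simp only [subst, ih]
    congr 1; funext i; congr 1; funext p x
    exact subst_lift _ σ τ p x

theorem lift_var (L : List Atom) {X : Ctx Atom} (p : Atom) (x : Var (L ++ X) p) :
    Subn.lift L (fun p (x : Var X p) => (Der.var x : Der B X p)) p x = Der.var x := by
  induction L with
  | nil => rfl
  | cons q L ih =>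
    cases x with
    | zero => rfl
    | succ x => exact congrArg (fun Ψ => Der.rename Ψ _) (ih x)

theorem subst_var {X : Ctx Atom} {p : Atom} (Φ : Der B X p) :
    (Φ.subst fun _ x => Der.var x) = Φ := by
  induction Φ with
  | var x => rfl
  | app R h Φs ih =>
    simp only [subst]
    congr 1; funext i
    conv_rhs => rw [← ih i]
    congr 1; funext p x
    exact lift_var _ p x

theorem mono_rename (h : B ⊆ C) {X : Ctx Atom} {p : Atom} (Φ : Der B X p) :
    ∀ {Y : Ctx Atom} (ρ : Ren X Y), (Φ.rename ρ).mono h = (Φ.mono h).rename ρ := by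
  induction Φ with
  | var x => intros; rfl
  | app R hR Φs ih =>
    intro Y ρ
    simp only [rename, mono, ih]

theorem mono_lift (h : B ⊆ C) (L : List Atom) {X Y : Ctx Atom} (σ : Subn B X Y) (p : Atom)
    (x : Var (L ++ X) p) :
    (Subn.lift L σ p x).mono h = Subn.lift L (fun p x => (σ p x).mono h) p x := by
  induction L with
  | nil => rfl
  | cons q L ih =>
    cases x with
    | zero => rfl
    | succ x =>
      change Der.mono h (Der.rename _ _) = Der.rename _ _
      rw [mono_rename, ← ih]

theorem mono_subst (h : B ⊆ C) {X : Ctx Atom} {p : Atom} (Φ : Der B X p) :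
    ∀ {Y : Ctx Atom} (σ : Subn B X Y),
      (Φ.subst σ).mono h = (Φ.mono h).subst fun p x => (σ p x).mono h := by
  induction Φ with
  | var x => intros; rfl
  | app R hR Φs ih =>
    intro Y σ
    simp only [subst, mono, ih]
    congr 1; funext i; congr 1; funext p x
    exact mono_lift h _ σ p x

theorem mono_mono (h : B ⊆ C) (k : C ⊆ D) {X : Ctx Atom} {p : Atom} (Φ : Der B X p) :
    (Φ.mono h).mono k = Φ.mono (h.trans k) := by
  induction Φ with
  | var x => rfl
  | app R hR Φs ih => simp only [mono, ih]

theorem mono_self (h : B ⊆ B) {X : Ctx Atom} {p : Atom} (Φ : Der B X p) : Φ.mono h = Φ := by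
  induction Φ with
  | var x => rfl
  | app R hR Φs ih => simp only [mono, ih]

end Der

/-- The objects `(B, (X : P))` of the category of bases and contexts. -/
structure World (Atom : Type u) : Type u where
  base : Base Atom
  ctx : Ctx Atom

/-- A morphism `(B, (X : P)) ⟶ (C, (Y : Q))`: an inclusion `C ⊆ B` and, for each variable of `Y`,
a derivation in `B` of its atom from `(X : P)`. -/
@[ext]
structure World.Hom {Atom : Type u} (v w : World Atom) : Type u where
  incl : w.base ⊆ v.base
  ders : ∀ p : Atom, Var w.ctx p → Der v.base v.ctx p

open CategoryTheory Opposite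

/-- The category of bases and contexts: identities are variables, composition is substitution. -/
instance World.category {Atom : Type u} : SmallCategory (World Atom) where
  Hom := World.Hom
  id _ := ⟨Set.Subset.rfl, fun _ x => .var x⟩
  comp f g := ⟨g.incl.trans f.incl, fun p z => ((g.ders p z).mono f.incl).subst f.ders⟩
  id_comp f := by
    apply World.Hom.ext
    funext p x
    simp only [Der.mono_self]
    exact Der.subst_var _
  comp_id f := by
    apply World.Hom.ext
    rfl
  assoc f g h := by
    apply World.Hom.ext
    funext p x
    simp only [Der.mono_subst, Der.mono_mono, Der.subst_subst]

/-- Presheaves on the category of bases and contexts. -/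
abbrev Psh (Atom : Type u) : Type (u + 1) := (World Atom)ᵒᵖ ⥤ Type u

namespace Psh

variable {Atom : Type u}

/-- The interpretation of an atom: derivations of it, acted upon by substitution. -/
def atom (p : Atom) : Psh Atom where
  obj w := Der w.unop.base w.unop.ctx p
  map f := TypeCat.ofHom fun Φ => (Φ.mono f.unop.incl).subst f.unop.ders
  map_id w := by
    ext Φ
    change (Der.mono _ Φ).subst (fun _ x => .var x) = Φ
    rw [Der.mono_self, Der.subst_var]
  map_comp f g := by
    ext Φ
    change (Der.mono _ Φ).subst
        (fun p z => ((f.unop.ders p z).mono g.unop.incl).subst g.unop.ders) =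
      (((Φ.mono f.unop.incl).subst f.unop.ders).mono g.unop.incl).subst g.unop.ders
    rw [Der.mono_subst, Der.mono_mono, Der.subst_subst]

/-- The exponential presheaf: `(F ⊃ G)(w) = Nat(Hom(-, w) × F, G)`. -/
def exp (F G : Psh Atom) : Psh Atom where
  obj w := FunctorToTypes.prod (yoneda.obj w.unop) F ⟶ G
  map f := TypeCat.ofHom fun α =>
    FunctorToTypes.prod.lift (FunctorToTypes.prod.fst ≫ yoneda.map f.unop)
      FunctorToTypes.prod.snd ≫ α
  map_id w := by
    ext α : 3
    change FunctorToTypes.prod.lift (FunctorToTypes.prod.fst ≫ yoneda.map (𝟙 w.unop))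
      FunctorToTypes.prod.snd ≫ α = α
    rw [yoneda.map_id]
    rfl
  map_comp f g := by
    ext α : 3
    change FunctorToTypes.prod.lift (FunctorToTypes.prod.fst ≫ yoneda.map (g.unop ≫ f.unop))
      FunctorToTypes.prod.snd ≫ α = _
    rw [yoneda.map_comp]
    rfl

/-- Quantification over atoms: `(∀ K)(w)` is the set of natural transformations from
`Hom(-, w)`, regarded as a functor on `Wᵒᵖ × A` that is constant in the discrete category `A` of
atoms, to `K`, that is, the set of families of natural transformations `Hom(-, w) ⟶ K(-, p)`. -/
def all (K : Atom → Psh Atom) : Psh Atom where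
  obj w := ∀ p : Atom, (yoneda.obj w.unop ⟶ K p)
  map f := TypeCat.ofHom fun α p => yoneda.map f.unop ≫ α p
  map_id w := by
    ext α : 3
    funext p
    change yoneda.map (𝟙 w.unop) ≫ α p = α p
    rw [yoneda.map_id, Category.id_comp]
  map_comp f g := by
    ext α : 3
    funext p
    change yoneda.map (g.unop ≫ f.unop) ≫ α p = yoneda.map g.unop ≫ yoneda.map f.unop ≫ α p
    rw [yoneda.map_comp, Category.assoc]

/-- The product of a family of presheaves, computed pointwise. -/
def pi {ι : Type u} (F : ι → Psh Atom) : Psh Atom where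
  obj w := ∀ i : ι, (F i).obj w
  map f := TypeCat.ofHom fun a i => (F i).map f (a i)
  map_id w := by
    ext a : 3
    funext i
    simp
  map_comp f g := by
    ext a : 3
    funext i
    simp

end Psh

/-- The interpretation `⟦φ⟧` of a formula as a presheaf. -/
def sem {Atom : Type u} : Formula Atom → Psh Atom
  | .atom p => Psh.atom p
  | .bot => Psh.all fun p => Psh.atom p
  | .and φ ψ => FunctorToTypes.prod (sem φ) (sem ψ)
  | .or φ ψ => Psh.all fun p =>
      Psh.exp (Psh.exp (sem φ) (Psh.atom p))
        (Psh.exp (Psh.exp (sem ψ) (Psh.atom p)) (Psh.atom p))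
  | .imp φ ψ => Psh.exp (sem φ) (sem ψ)

/-- The interpretation `⟦Γ⟧` of a finite set of formulae: the product of the `⟦ψ⟧`, `ψ ∈ Γ`. -/
def semCtx {Atom : Type u} (Γ : Finset (Formula Atom)) : Psh Atom :=
  Psh.pi fun ψ : {ψ : Formula Atom // ψ ∈ Γ} => sem ψ.1

/-- Categorical base-extension validity `Γ ⊨ φ`: there is a natural transformation `⟦Γ⟧ ⟶ ⟦φ⟧`. -/
def CatValid {Atom : Type u} (Γ : Finset (Formula Atom)) (φ : Formula Atom) : Prop :=
  Nonempty (semCtx Γ ⟶ sem φ)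

end

end BaseExt

/-!
Both notions of validity are instances of Kripke forcing with the second-order reading of `⊥` and
`∨`: `⊩_B φ` says that the base `B` forces `φ`, bases being ordered by inclusion, and a natural
transformation `F ⟶ ⟦φ⟧` exists iff the presheaf `F` forces `φ`, where `G` lies above `F` when there
is a natural transformation `G ⟶ F`. In both models an atomic base can be imposed without adding
consequences: it holds at some world above which only its own consequences between atoms hold. Such
models all have the same consequences. Indeed, name the finitely many subformulae of `Γ, φ` by atoms
(compound ones by fresh atoms) and let `N` be the base of natural deduction rules between these
names. At a world where `N` holds, a subformula and its name are equivalent, so a consequence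
`Γ ⊨ φ` of the model yields a derivation of the name of `φ` from those of `Γ` in `N`; replacing the
names in it by what they name, one sees that every model has the consequence.
-/

namespace BaseExt

open CategoryTheory Opposite

noncomputable section

variable {Atom : Type u}

/-! ### Forcing -/

section Forcing

variable {W : Type*} [Preorder W] {V : Atom → UpperSet W} {v w : W} {φ ψ χ : Formula Atom}

/-- The forcing relation of the Kripke model on `W` with valuation `V`. Absurdity and disjunction
have the clauses of their second-order encodings, the quantifiers ranging over atoms only. -/
def Forces (V : Atom → UpperSet W) : Formula Atom → W → Prop
  | .atom p, w => w ∈ V p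
  | .bot, w => ∀ p, w ∈ V p
  | .and φ ψ, w => Forces V φ w ∧ Forces V ψ w
  | .or φ ψ, w => ∀ p, ∀ v ≥ w, (∀ u ≥ v, Forces V φ u → u ∈ V p) →
      (∀ u ≥ v, Forces V ψ u → u ∈ V p) → v ∈ V p
  | .imp φ ψ, w => ∀ v ≥ w, Forces V φ v → Forces V ψ v

/-- The consequence relation of the Kripke model on `W` with valuation `V`. -/
def Consequence (V : Atom → UpperSet W) (Γ : Finset (Formula Atom)) (φ : Formula Atom) : Prop :=
  ∀ w, (∀ ψ ∈ Γ, Forces V ψ w) → Forces V φ w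

theorem Forces.mono (hwv : w ≤ v) (h : Forces V φ w) : Forces V φ v := by
  induction φ with
  | atom p => exact (V p).upper hwv h
  | bot => exact fun p => (V p).upper hwv (h p)
  | and φ ψ ihφ ihψ => exact ⟨ihφ h.1, ihψ h.2⟩
  | or φ ψ => exact fun p u hu => h p u (hwv.trans hu)
  | imp φ ψ => exact fun u hu => h u (hwv.trans hu)

theorem Forces.bot_elim (h : Forces V .bot w) : Forces V χ w := by
  induction χ generalizing w with
  | atom p => exact h p
  | bot => exact h
  | and α β ihα ihβ => exact ⟨ihα h, ihβ h⟩
  | or α β => exact fun p v hv _ _ => h.mono hv p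
  | imp _ _ _ ihβ => exact fun v hv _ => ihβ (h.mono hv)

theorem Forces.or_inl (h : Forces V φ w) : Forces V (.or φ ψ) w :=
  fun _ v hv hφ _ => hφ v le_rfl (h.mono hv)

theorem Forces.or_inr (h : Forces V ψ w) : Forces V (.or φ ψ) w :=
  fun _ v hv _ hψ => hψ v le_rfl (h.mono hv)

/-- The clause for disjunction eliminates into atoms only; compound conclusions are reached by
induction. -/
theorem Forces.or_elim (h : Forces V (.or φ ψ) w) (hφ : ∀ v ≥ w, Forces V φ v → Forces V χ v)
    (hψ : ∀ v ≥ w, Forces V ψ v → Forces V χ v) : Forces V χ w := by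
  induction χ generalizing w with
  | atom p => exact h p w le_rfl hφ hψ
  | bot => exact fun p => h p w le_rfl (fun v hv hv' => hφ v hv hv' p) fun v hv hv' => hψ v hv hv' p
  | and α β ihα ihβ =>
    exact ⟨ihα h (fun v hv hv' => (hφ v hv hv').1) fun v hv hv' => (hψ v hv hv').1,
      ihβ h (fun v hv hv' => (hφ v hv hv').2) fun v hv hv' => (hψ v hv hv').2⟩
  | or α β =>
    intro p v hv hα hβ
    have elim_at {u : W} (hu : u ≥ v) (h' : Forces V (.or α β) u) : u ∈ V p :=
      h' p u le_rfl (fun t ht => hα t (hu.trans ht)) fun t ht => hβ t (hu.trans ht)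
    exact h p v hv (fun u hu hu' => elim_at hu (hφ u (hv.trans hu) hu'))
      fun u hu hu' => elim_at hu (hψ u (hv.trans hu) hu')
  | imp α β _ ihβ =>
    intro v hv hα
    exact ihβ (h.mono hv) (fun u hu hu' => hφ u (hv.trans hu) hu' u le_rfl (hα.mono hu))
      fun u hu hu' => hψ u (hv.trans hu) hu' u le_rfl (hα.mono hu)

/-- The set of worlds forcing a formula, for use as the value of an atom in a new valuation. -/
def forcingSet (V : Atom → UpperSet W) (φ : Formula Atom) : UpperSet W where
  carrier := {w | Forces V φ w}
  upper' _ _ hwv h := h.mono hwv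

@[simp]
theorem mem_forcingSet : w ∈ forcingSet V φ ↔ Forces V φ w := Iff.rfl

/-- An atomic rule holds at a world if the world forces it, read as an implication between atoms. -/
def ForcesRule (V : Atom → UpperSet W) (R : AtomicRule Atom) (w : W) : Prop :=
  ∀ v ≥ w, (∀ s ∈ R.prems, ∀ u ≥ v, (∀ a ∈ s.1, u ∈ V a) → u ∈ V s.2) → v ∈ V R.concl

/-- A base holds at a world if all of its rules do. -/
def ForcesBase (V : Atom → UpperSet W) (B : Base Atom) (w : W) : Prop :=
  ∀ R ∈ B, ForcesRule V R w

theorem ForcesBase.mono {B : Base Atom} (hwv : w ≤ v) (h : ForcesBase V B w) : ForcesBase V B v :=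
  fun R hR u hu => h R hR u (hwv.trans hu)

@[simp]
theorem forall_ge_mem_iff {S : UpperSet W} : (∀ v ≥ w, v ∈ S) ↔ w ∈ S :=
  ⟨fun h => h w le_rfl, fun h _ hv => S.upper hv h⟩

@[simp]
theorem forall_ge_forces_iff : (∀ v ≥ w, Forces V φ v) ↔ Forces V φ w :=
  forall_ge_mem_iff (S := forcingSet V φ)

theorem Entails.mem_of_forcesBase {B : Base Atom} {P : Set Atom} {p : Atom} (h : Entails B P p)
    (hB : ForcesBase V B w) (hP : ∀ a ∈ P, w ∈ V a) : w ∈ V p := by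
  induction h generalizing w with
  | ref hp => exact hP _ hp
  | app R hR _ ih =>
    refine hB R hR w le_rfl fun s hs v hv hs' => ?_
    obtain ⟨i, rfl⟩ := List.get_of_mem hs
    refine ih i (hB.mono hv) ?_
    rintro a (ha | ha)
    · exact (V a).upper hv (hP a ha)
    · exact hs' a ha

end Forcing

/-! ### Naming subformulae by atoms -/

section Naming

/-- The set of subformulae of a formula, including the formula itself. -/
def Formula.subformulas : Formula Atom → Set (Formula Atom)
  | .atom p => {.atom p}
  | .bot => {.bot}
  | .and φ ψ => insert (.and φ ψ) (φ.subformulas ∪ ψ.subformulas)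
  | .or φ ψ => insert (.or φ ψ) (φ.subformulas ∪ ψ.subformulas)
  | .imp φ ψ => insert (.imp φ ψ) (φ.subformulas ∪ ψ.subformulas)

theorem Formula.self_mem_subformulas (φ : Formula Atom) : φ ∈ φ.subformulas := by
  cases φ <;> simp [subformulas]

theorem Formula.finite_subformulas (φ : Formula Atom) : φ.subformulas.Finite := by
  induction φ <;> simp_all [subformulas]

/-- Closure of a set of formulae under immediate subformulae. -/
structure SubClosed (T : Set (Formula Atom)) : Prop where
  and {φ ψ} : Formula.and φ ψ ∈ T → φ ∈ T ∧ ψ ∈ T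
  or {φ ψ} : Formula.or φ ψ ∈ T → φ ∈ T ∧ ψ ∈ T
  imp {φ ψ} : Formula.imp φ ψ ∈ T → φ ∈ T ∧ ψ ∈ T

theorem Formula.subClosed_subformulas (φ : Formula Atom) : SubClosed φ.subformulas := by
  induction φ with
  | atom | bot => constructor <;> simp [subformulas]
  | and φ ψ ihφ ihψ | or φ ψ ihφ ihψ | imp φ ψ ihφ ihψ =>
    have hφ := φ.self_mem_subformulas
    have hψ := ψ.self_mem_subformulas
    constructor <;> intro α β h <;> simp only [subformulas, Set.mem_insert_iff, Set.mem_union] at *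
      <;> grind [ihφ.and, ihφ.or, ihφ.imp, ihψ.and, ihψ.or, ihψ.imp]

theorem SubClosed.biUnion {ι : Type*} {s : Set ι} {T : ι → Set (Formula Atom)}
    (hT : ∀ i ∈ s, SubClosed (T i)) : SubClosed (⋃ i ∈ s, T i) := by
  constructor <;> intro φ ψ h <;> obtain ⟨i, hi, h⟩ := Set.mem_iUnion₂.1 h
  · exact ((hT i hi).and h).imp (Set.mem_biUnion hi) (Set.mem_biUnion hi)
  · exact ((hT i hi).or h).imp (Set.mem_biUnion hi) (Set.mem_biUnion hi)
  · exact ((hT i hi).imp h).imp (Set.mem_biUnion hi) (Set.mem_biUnion hi)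

theorem exists_leftInverse_injOn {α β : Type*} [Infinite α] {f : α → β} (hf : f.Injective)
    {T : Set β} (hT : T.Finite) : ∃ e : β → α, e.LeftInverse f ∧ Set.InjOn e T := by
  have fresh_infinite : (f ⁻¹' T)ᶜ.Infinite := (hT.preimage hf.injOn).infinite_compl
  obtain ⟨c, hcT, hc⟩ := hT.exists_injOn_of_encard_le (t := (f ⁻¹' T)ᶜ) (by
    simp [fresh_infinite.encard_eq])
  refine ⟨f.extend id c, hf.extend_apply id c, fun x hx y hy hxy => ?_⟩
  have extend_eq_c {z : β} (hz : z ∉ Set.range f) : f.extend id c z = c z :=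
    Function.extend_apply' id c z hz
  by_cases hxf : x ∈ Set.range f <;> by_cases hyf : y ∈ Set.range f
  · obtain ⟨⟨a, rfl⟩, ⟨b, rfl⟩⟩ := hxf, hyf
    rw [hf.extend_apply, hf.extend_apply] at hxy
    exact congrArg f hxy
  · obtain ⟨a, rfl⟩ := hxf
    rw [hf.extend_apply, extend_eq_c hyf, id] at hxy
    exact absurd (hxy ▸ hx) (hcT hy)
  · obtain ⟨b, rfl⟩ := hyf
    rw [hf.extend_apply, extend_eq_c hxf, id] at hxy
    exact absurd (hxy ▸ hy) (hcT hx)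
  · rw [extend_eq_c hxf, extend_eq_c hyf] at hxy
    exact hc hx hy hxy

end Naming

/-! ### The base of natural deduction -/

section NaturalDeduction

/-- The rules of natural deduction for the formulae in `T`, each formula `χ` being replaced by the
atom `e χ` that names it. The conclusions of the eliminations of `∨` and `⊥` are arbitrary atoms. -/
inductive NatDed (e : Formula Atom → Atom) (T : Set (Formula Atom)) : Base Atom
  | andI {φ ψ} : Formula.and φ ψ ∈ T → NatDed e T ⟨[(∅, e φ), (∅, e ψ)], e (.and φ ψ)⟩
  | andE₁ {φ ψ} : Formula.and φ ψ ∈ T → NatDed e T ⟨[(∅, e (.and φ ψ))], e φ⟩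
  | andE₂ {φ ψ} : Formula.and φ ψ ∈ T → NatDed e T ⟨[(∅, e (.and φ ψ))], e ψ⟩
  | impI {φ ψ} : Formula.imp φ ψ ∈ T → NatDed e T ⟨[({e φ}, e ψ)], e (.imp φ ψ)⟩
  | impE {φ ψ} : Formula.imp φ ψ ∈ T → NatDed e T ⟨[(∅, e (.imp φ ψ)), (∅, e φ)], e ψ⟩
  | orI₁ {φ ψ} : Formula.or φ ψ ∈ T → NatDed e T ⟨[(∅, e φ)], e (.or φ ψ)⟩
  | orI₂ {φ ψ} : Formula.or φ ψ ∈ T → NatDed e T ⟨[(∅, e ψ)], e (.or φ ψ)⟩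
  | orE {φ ψ} (r : Atom) : Formula.or φ ψ ∈ T →
      NatDed e T ⟨[(∅, e (.or φ ψ)), ({e φ}, r), ({e ψ}, r)], r⟩
  | botE (r : Atom) : Formula.bot ∈ T → NatDed e T ⟨[(∅, e .bot)], r⟩

variable {W : Type*} [Preorder W] {V : Atom → UpperSet W} {w : W} {e : Formula Atom → Atom}
  {T : Set (Formula Atom)} {φ ψ : Formula Atom}

theorem forcesBase_natDed (hT : SubClosed T) {d : Atom → Formula Atom} (hd : Set.LeftInvOn d e T) :
    ForcesBase (fun a => forcingSet V (d a)) (NatDed e T) w := by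
  intro R hR
  cases hR with
  | andI h =>
    have hs := hT.and h
    simpa [ForcesRule, hd h, hd hs.1, hd hs.2] using fun v _ hφ hψ => ⟨hφ, hψ⟩
  | andE₁ h =>
    simpa [ForcesRule, hd h, hd (hT.and h).1] using fun v _ h => h.1
  | andE₂ h =>
    simpa [ForcesRule, hd h, hd (hT.and h).2] using fun v _ h => h.2
  | impI h =>
    have hs := hT.imp h
    simpa [ForcesRule, hd h, hd hs.1, hd hs.2] using! fun v _ h => h
  | impE h =>
    have hs := hT.imp h
    simpa [ForcesRule, hd h, hd hs.1, hd hs.2] using fun v _ h => h v le_rfl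
  | orI₁ h =>
    simpa [ForcesRule, hd h, hd (hT.or h).1] using fun v _ => Forces.or_inl
  | orI₂ h =>
    simpa [ForcesRule, hd h, hd (hT.or h).2] using fun v _ => Forces.or_inr
  | orE r h =>
    have hs := hT.or h
    simpa [ForcesRule, hd h, hd hs.1, hd hs.2] using fun v _ => Forces.or_elim
  | botE r h =>
    simpa [ForcesRule, hd h] using fun v _ => Forces.bot_elim

theorem mem_name_bot_iff (hw : ForcesBase V (NatDed e T) w) (h : Formula.bot ∈ T) :
    w ∈ V (e .bot) ↔ ∀ p, w ∈ V p :=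
  ⟨fun hbot p => hw _ (.botE p h) w le_rfl (by simpa using hbot), fun hall => hall _⟩

theorem mem_name_and_iff (hw : ForcesBase V (NatDed e T) w) (h : Formula.and φ ψ ∈ T) :
    w ∈ V (e (.and φ ψ)) ↔ w ∈ V (e φ) ∧ w ∈ V (e ψ) :=
  ⟨fun hand => ⟨hw _ (.andE₁ h) w le_rfl (by simpa using hand),
      hw _ (.andE₂ h) w le_rfl (by simpa using hand)⟩,
    fun hφψ => hw _ (.andI h) w le_rfl (by simpa using hφψ)⟩

theorem mem_name_imp_iff (hw : ForcesBase V (NatDed e T) w) (h : Formula.imp φ ψ ∈ T) :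
    w ∈ V (e (.imp φ ψ)) ↔ ∀ v ≥ w, v ∈ V (e φ) → v ∈ V (e ψ) :=
  ⟨fun himp v hv hφ => hw _ (.impE h) v hv (by simpa using ⟨(V _).upper hv himp, hφ⟩),
    fun hφψ => hw _ (.impI h) w le_rfl (by simpa using hφψ)⟩

theorem mem_name_or_iff (hw : ForcesBase V (NatDed e T) w) (h : Formula.or φ ψ ∈ T) :
    w ∈ V (e (.or φ ψ)) ↔ ∀ p, ∀ v ≥ w, (∀ u ≥ v, u ∈ V (e φ) → u ∈ V p) →
      (∀ u ≥ v, u ∈ V (e ψ) → u ∈ V p) → v ∈ V p := by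
  refine ⟨fun hor p v hv hφ hψ => ?_, fun helim => helim (e (.or φ ψ)) w le_rfl ?_ ?_⟩
  · exact hw _ (.orE p h) v hv (by simpa using ⟨(V _).upper hv hor, hφ, hψ⟩)
  · exact fun v hv hφ => hw _ (.orI₁ h) v hv (by simpa using hφ)
  · exact fun v hv hψ => hw _ (.orI₂ h) v hv (by simpa using hψ)

theorem forces_iff_mem_name (hw : ForcesBase V (NatDed e T) w) (hT : SubClosed T)
    (he : e.LeftInverse .atom) (hφ : φ ∈ T) : Forces V φ w ↔ w ∈ V (e φ) := by
  induction φ generalizing w with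
  | atom p => rw [he p, Forces]
  | bot => exact (mem_name_bot_iff hw hφ).symm
  | and φ ψ ihφ ihψ =>
    rw [mem_name_and_iff hw hφ, Forces, ihφ hw (hT.and hφ).1, ihψ hw (hT.and hφ).2]
  | imp φ ψ ihφ ihψ =>
    rw [mem_name_imp_iff hw hφ, Forces]
    exact forall₂_congr fun v hv =>
      imp_congr (ihφ (hw.mono hv) (hT.imp hφ).1) (ihψ (hw.mono hv) (hT.imp hφ).2)
  | or φ ψ ihφ ihψ =>
    have ihφ_iff {v : W} (hv : v ≥ w) := ihφ (hw.mono hv) (hT.or hφ).1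
    have ihψ_iff {v : W} (hv : v ≥ w) := ihψ (hw.mono hv) (hT.or hφ).2
    rw [mem_name_or_iff hw hφ, Forces]
    refine forall₃_congr fun p v hv => imp_congr ?_ (imp_congr ?_ Iff.rfl)
    · exact forall₂_congr fun u hu => imp_congr (ihφ_iff (hv.trans hu)) Iff.rfl
    · exact forall₂_congr fun u hu => imp_congr (ihψ_iff (hv.trans hu)) Iff.rfl

end NaturalDeduction

/-! ### Generic models -/

section Generic

variable {W : Type*} [Preorder W] {V : Atom → UpperSet W} {e : Formula Atom → Atom}
  {T : Set (Formula Atom)} {Γ : Finset (Formula Atom)} {φ : Formula Atom}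

/-- A valuation is generic if every base holds at some world above which the base accounts for all
consequences between atoms. -/
def IsGeneric (V : Atom → UpperSet W) : Prop :=
  ∀ B : Base Atom, ∃ w, ForcesBase V B w ∧
    ∀ (P : Finset Atom) (q : Atom), (∀ v ≥ w, (∀ a ∈ P, v ∈ V a) → v ∈ V q) → Entails B P q

theorem IsGeneric.entails_natDed [DecidableEq Atom] (hV : IsGeneric V) (hT : SubClosed T)
    (he : e.LeftInverse .atom) (hΓT : ∀ ψ ∈ Γ, ψ ∈ T) (hφT : φ ∈ T) (h : Consequence V Γ φ) :
    Entails (NatDed e T) (Γ.image e : Finset Atom) (e φ) := by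
  obtain ⟨w, hw, entails_of_consequence⟩ := hV (NatDed e T)
  refine entails_of_consequence _ _ fun v hv hΓ => ?_
  refine (forces_iff_mem_name (hw.mono hv) hT he hφT).1 (h v fun ψ hψ => ?_)
  exact (forces_iff_mem_name (hw.mono hv) hT he (hΓT ψ hψ)).2 (hΓ _ (Finset.mem_image_of_mem e hψ))

theorem Consequence.of_entails_natDed [DecidableEq Atom] (hT : SubClosed T)
    (he : Set.InjOn e T) (hΓT : ∀ ψ ∈ Γ, ψ ∈ T) (hφT : φ ∈ T)
    (h : Entails (NatDed e T) (Γ.image e : Finset Atom) (e φ)) : Consequence V Γ φ := by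
  have : Nonempty (Formula Atom) := ⟨φ⟩
  have hd := he.leftInvOn_invFunOn
  intro w hΓ
  have hφ := h.mem_of_forcesBase (forcesBase_natDed (V := V) (w := w) hT hd) fun a ha => by
    obtain ⟨ψ, hψ, rfl⟩ := Finset.mem_image.1 (Finset.mem_coe.1 ha)
    simpa [hd (hΓT ψ hψ)] using hΓ ψ hψ
  simpa [hd hφT] using hφ

theorem IsGeneric.consequence [Infinite Atom] {W' : Type*} [Preorder W'] {V' : Atom → UpperSet W'}
    (hV : IsGeneric V) (h : Consequence V Γ φ) : Consequence V' Γ φ := by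
  classical
  let T : Set (Formula Atom) := ⋃ χ ∈ (↑(insert φ Γ) : Set (Formula Atom)), χ.subformulas
  have hT : SubClosed T := .biUnion fun χ _ => χ.subClosed_subformulas
  have hT_fin : T.Finite := (Finset.finite_toSet _).biUnion fun χ _ => χ.finite_subformulas
  have mem_T {χ : Formula Atom} (hχ : χ ∈ insert φ Γ) : χ ∈ T :=
    Set.mem_biUnion (Finset.mem_coe.2 hχ) χ.self_mem_subformulas
  have hφT : φ ∈ T := mem_T (Finset.mem_insert_self φ Γ)
  have hΓT : ∀ ψ ∈ Γ, ψ ∈ T := fun ψ hψ => mem_T (Finset.mem_insert_of_mem hψ)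
  have atom_injective : Function.Injective (Formula.atom : Atom → Formula Atom) :=
    fun _ _ h => Formula.atom.inj h
  obtain ⟨e, he_atom, he_inj⟩ := exists_leftInverse_injOn atom_injective hT_fin
  exact .of_entails_natDed hT he_inj hΓT hφT (hV.entails_natDed hT he_atom hΓT hφT h)

end Generic

/-! ### The model of bases -/

section Bases

variable {B C : Base Atom} {P Q : Set Atom} {p : Atom}

theorem Entails.mono (hBC : B ⊆ C) (h : Entails B P p) (hPQ : P ⊆ Q) : Entails C Q p := by
  induction h generalizing Q with
  | ref hp => exact .ref (hPQ hp)
  | app R hR _ ih => exact .app R (hBC hR) fun i => ih i (Set.union_subset_union_left _ hPQ)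

/-- The base of the rules `⇒ a` without premises, for `a ∈ P`. -/
def Base.facts (P : Set Atom) : Base Atom := {R | R.prems = [] ∧ R.concl ∈ P}

theorem Entails.of_mem_facts (hp : p ∈ P) : Entails (B ∪ Base.facts P) Q p :=
  .app ⟨[], p⟩ (.inr ⟨rfl, hp⟩) fun i => i.elim0

theorem Entails.of_union_facts (h : Entails (B ∪ Base.facts P) Q p) : Entails B (Q ∪ P) p := by
  induction h with
  | ref hp => exact .ref (.inl hp)
  | app R hR _ ih =>
    rcases hR with hR | ⟨-, hR⟩
    · exact .app R hR fun i => Set.union_right_comm _ P _ ▸ ih i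
    · exact .ref (.inr hR)

/-- The bases in which an atom is derivable. -/
def basesDeriving (p : Atom) : UpperSet (Base Atom) where
  carrier := {B | Entails B ∅ p}
  upper' _ _ hBC h := h.mono hBC subset_rfl

@[simp]
theorem mem_basesDeriving : B ∈ basesDeriving p ↔ Entails B ∅ p := Iff.rfl

theorem forces_basesDeriving_iff {φ : Formula Atom} :
    Forces basesDeriving φ B ↔ ValidIn φ B := by
  induction φ generalizing B with
  | atom | bot => rfl
  | and φ ψ ihφ ihψ | or φ ψ ihφ ihψ | imp φ ψ ihφ ihψ =>
    simp only [Forces, ValidIn, ihφ, ihψ, mem_basesDeriving, ge_iff_le]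

theorem valid_iff_consequence {Γ : Finset (Formula Atom)} {φ : Formula Atom} :
    Valid Γ φ ↔ Consequence basesDeriving Γ φ := by
  simp only [Valid, Consequence, forces_basesDeriving_iff]

theorem entails_of_forall_extension
    (h : ∀ C ⊇ B, (∀ a ∈ P, Entails C ∅ a) → Entails C ∅ p) : Entails B P p := by
  rw [← Set.empty_union P]
  exact .of_union_facts (h _ Set.subset_union_left fun a ha => .of_mem_facts ha)

theorem isGeneric_basesDeriving : IsGeneric (basesDeriving (Atom := Atom)) := by
  refine fun B => ⟨B, fun R hR C hC hprems => ?_, fun P q => entails_of_forall_extension⟩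
  refine .app R (hC hR) fun i => ?_
  rw [Set.empty_union]
  exact entails_of_forall_extension (hprems _ (List.get_mem R.prems i))

end Bases

/-! ### The model of presheaves -/

section Contexts

variable {B : Base Atom} {L : List Atom} {X Y : Ctx Atom} {p : Atom}

theorem Var.mem (x : Var X p) : p ∈ X := by
  induction x with
  | zero => exact List.mem_cons_self
  | succ _ ih => exact List.mem_cons_of_mem _ ih

theorem Var.nonempty_of_mem (h : p ∈ X) : Nonempty (Var X p) := by
  induction h with
  | head => exact ⟨.zero⟩
  | tail _ _ ih => exact ih.map .succ

theorem Der.entails (Φ : Der B X p) : Entails B {a | a ∈ X} p := by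
  induction Φ with
  | var x => exact .ref x.mem
  | app R hR _ ih =>
    refine .app R hR fun i => (ih i).mono subset_rfl fun a ha => ?_
    simpa [or_comm] using ha

/-- The inclusion of the first part of a context. -/
def Var.inl {X : Ctx Atom} {p : Atom} (Y : Ctx Atom) : Var X p → Var (X ++ Y) p
  | .zero => .zero
  | .succ x => .succ (x.inl Y)

/-- The inclusion of the second part of a context. -/
def Var.inr : (X : Ctx Atom) → Var Y p → Var (X ++ Y) p
  | [], y => y
  | _ :: X, y => .succ (y.inr X)

theorem Subn.lift_inl (σ : Subn B X Y) (x : Var L p) :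
    Subn.lift L σ p (x.inl X) = .var (x.inl Y) := by
  induction x with
  | zero => rfl
  | succ x ih => exact congrArg (fun Ψ => Der.rename Ψ _) ih

theorem Subn.lift_inr (σ : Subn B X Y) (x : Var X p) :
    Subn.lift L σ p (x.inr L) = (σ p x).subst fun _ y => .var (y.inr L) := by
  induction L with
  | nil => exact (Der.subst_var _).symm
  | cons q L ih =>
    refine (congrArg (fun Ψ => Der.rename Ψ _) ih).trans ?_
    rw [Der.rename_subst]
    rfl

variable {v w : World Atom}

/-- The extension of the context of a world by one variable for each entry of `L`. -/
def World.extend (L : List Atom) (w : World Atom) : World Atom := ⟨w.base, L ++ w.ctx⟩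

/-- The projection that forgets the variables added by `World.extend`. -/
def World.proj (L : List Atom) (w : World Atom) : w.extend L ⟶ w :=
  ⟨subset_rfl, fun _ x => .var (x.inr L)⟩

/-- The functorial action of `World.extend`. -/
def World.extendMap (L : List Atom) (f : v ⟶ w) : v.extend L ⟶ w.extend L :=
  ⟨f.incl, Subn.lift L f.ders⟩

theorem World.extendMap_proj (L : List Atom) (f : v ⟶ w) :
    World.extendMap L f ≫ w.proj L = v.proj L ≫ f := by
  apply World.Hom.ext
  funext p x
  change Subn.lift L f.ders p (x.inr L) =
    (Der.mono (subset_refl v.base) (f.ders p x)).subst fun _ y => .var (y.inr L)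
  rw [Subn.lift_inr, Der.mono_self]

end Contexts

namespace Psh

section UniversalProperties

variable {F G H : Psh Atom}

/-- Transposition of a natural transformation out of a product. -/
def curry (γ : FunctorToTypes.prod H F ⟶ G) : H ⟶ exp F G where
  app w := TypeCat.ofHom fun x =>
    FunctorToTypes.prod.lift (FunctorToTypes.prod.fst ≫ yonedaEquiv.symm x)
      FunctorToTypes.prod.snd ≫ γ
  naturality v w f := by
    ext x : 3
    change FunctorToTypes.prod.lift (FunctorToTypes.prod.fst ≫ yonedaEquiv.symm (H.map f x))
      FunctorToTypes.prod.snd ≫ γ = FunctorToTypes.prod.lift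
        (FunctorToTypes.prod.fst ≫ yoneda.map f.unop ≫ yonedaEquiv.symm x)
        FunctorToTypes.prod.snd ≫ γ
    rw [yonedaEquiv_symm_naturality_left]
    rfl

/-- The component of an element of an exponential at a morphism. -/
def evalAt {w : (World Atom)ᵒᵖ} (α : (exp F G).obj w) {v : (World Atom)ᵒᵖ}
    (f : v.unop ⟶ w.unop) (y : F.obj v) : G.obj v :=
  NatTrans.app (F := FunctorToTypes.prod (yoneda.obj w.unop) F) α v (f, y)

theorem map_evalAt {u v w : (World Atom)ᵒᵖ} (α : (exp F G).obj w) (f : v.unop ⟶ w.unop)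
    (y : F.obj v) (g : v ⟶ u) :
    G.map g (evalAt α f y) = evalAt α (g.unop ≫ f) (F.map g y) :=
  (NatTrans.naturality_apply (F := FunctorToTypes.prod (yoneda.obj w.unop) F) α g
    ((f, y) : (FunctorToTypes.prod (yoneda.obj w.unop) F).obj v)).symm

/-- Transposition of a natural transformation into an exponential. -/
def uncurry (α : H ⟶ exp F G) : FunctorToTypes.prod H F ⟶ G where
  app w := TypeCat.ofHom fun x => evalAt (α.app w x.1) (𝟙 w.unop) x.2
  naturality v w f := by
    ext ⟨x, y⟩
    change evalAt (α.app w (H.map f x)) (𝟙 w.unop) (F.map f y) =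
      G.map f (evalAt (α.app v x) (𝟙 v.unop) y)
    rw [NatTrans.naturality_apply α f x, map_evalAt]
    change evalAt (α.app v x) (𝟙 w.unop ≫ f.unop) (F.map f y) = _
    rw [Category.id_comp, Category.comp_id]

/-- The component of an element of a quantification at an atom. -/
def allProj (K : Atom → Psh Atom) (p : Atom) : all K ⟶ K p where
  app w := TypeCat.ofHom fun α => yonedaEquiv (show yoneda.obj w.unop ⟶ K p from α p)
  naturality v w f := by
    ext α
    exact (yonedaEquiv_naturality' (show yoneda.obj v.unop ⟶ K p from α p) f).symm

/-- The natural transformation into a quantification with given components. -/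
def allLift {K : Atom → Psh Atom} (γ : ∀ p, H ⟶ K p) : H ⟶ all K where
  app w := TypeCat.ofHom fun x p => yonedaEquiv.symm x ≫ γ p
  naturality v w f := by
    ext x : 3
    funext p
    change yonedaEquiv.symm (H.map f x) ≫ γ p = yoneda.map f.unop ≫ yonedaEquiv.symm x ≫ γ p
    rw [← Category.assoc, yonedaEquiv_symm_naturality_left]
    rfl

variable {ι : Type u}

/-- The projection of a product to a factor. -/
def piProj (F : ι → Psh Atom) (i : ι) : pi F ⟶ F i where
  app _ := TypeCat.ofHom fun a => a i

/-- The natural transformation into a product with given components. -/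
def piLift {F : ι → Psh Atom} (γ : ∀ i, H ⟶ F i) : H ⟶ pi F where
  app w := TypeCat.ofHom fun x i => (γ i).app w x
  naturality v w f := by
    ext x : 3
    funext i
    exact NatTrans.naturality_apply (γ i) f x

theorem nonempty_hom_prod_iff :
    Nonempty (H ⟶ FunctorToTypes.prod F G) ↔ Nonempty (H ⟶ F) ∧ Nonempty (H ⟶ G) :=
  ⟨fun ⟨α⟩ => ⟨⟨α ≫ FunctorToTypes.prod.fst⟩, ⟨α ≫ FunctorToTypes.prod.snd⟩⟩,
    fun ⟨⟨α⟩, ⟨β⟩⟩ => ⟨FunctorToTypes.prod.lift α β⟩⟩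

theorem nonempty_hom_exp_iff :
    Nonempty (H ⟶ exp F G) ↔
      ∀ H' : Psh Atom, Nonempty (H' ⟶ H) → Nonempty (H' ⟶ F) → Nonempty (H' ⟶ G) :=
  ⟨fun ⟨α⟩ _ ⟨β⟩ ⟨γ⟩ => ⟨FunctorToTypes.prod.lift β γ ≫ uncurry α⟩,
    fun h => (h _ ⟨FunctorToTypes.prod.fst⟩ ⟨FunctorToTypes.prod.snd⟩).map curry⟩

theorem nonempty_hom_all_iff {K : Atom → Psh Atom} :
    Nonempty (H ⟶ all K) ↔ ∀ p, Nonempty (H ⟶ K p) :=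
  ⟨fun ⟨α⟩ p => ⟨α ≫ allProj K p⟩, fun h => ⟨allLift fun p => (h p).some⟩⟩

theorem nonempty_hom_pi_iff {F : ι → Psh Atom} :
    Nonempty (H ⟶ pi F) ↔ ∀ i, Nonempty (H ⟶ F i) :=
  ⟨fun ⟨α⟩ i => ⟨α ≫ piProj F i⟩, fun h => ⟨piLift fun i => (h i).some⟩⟩

end UniversalProperties

section Rules

variable {F : Psh Atom} {B : Base Atom} {L : List Atom} {q : Atom} {v w : World Atom}

/-- The presheaf of derivations of all atoms in `L`. -/
def assumptions (L : List Atom) : Psh Atom := pi fun a : {a // a ∈ L} => atom a.1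

theorem nonempty_hom_assumptions_iff :
    Nonempty (F ⟶ assumptions L) ↔ ∀ a ∈ L, Nonempty (F ⟶ atom a) :=
  nonempty_hom_pi_iff.trans Subtype.forall

/-- The variables for the atoms in `L` after extension of the context by `L`. -/
def newVars (L : List Atom) (w : World Atom) : (assumptions L).obj (op (w.extend L)) :=
  fun a => .var ((Var.nonempty_of_mem a.2).some.inl w.ctx)

theorem map_newVars (f : v ⟶ w) :
    (assumptions L).map (World.extendMap L f).op (newVars L w) = newVars L v := by
  funext a
  exact Subn.lift_inl _ _

/-- The derivation of `q`, with the variables for `L` still free, that a natural transformation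
yields when it is applied to these variables. -/
def premise (γ : FunctorToTypes.prod F (assumptions L) ⟶ atom q) (x : F.obj (op w)) :
    Der w.base (L ++ w.ctx) q :=
  γ.app (op (w.extend L)) (F.map (w.proj L).op x, newVars L w)

theorem premise_map (γ : FunctorToTypes.prod F (assumptions L) ⟶ atom q) (f : v ⟶ w)
    (x : F.obj (op w)) :
    premise γ (F.map f.op x) = ((premise γ x).mono f.incl).subst (Subn.lift L f.ders) := by
  let z : (FunctorToTypes.prod F (assumptions L)).obj (op (w.extend L)) :=
    (F.map (w.proj L).op x, newVars L w)
  refine Eq.trans ?_ (NatTrans.naturality_apply γ (World.extendMap L f).op z)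
  refine congrArg _ (Prod.ext ?_ (map_newVars f).symm)
  change F.map (v.proj L).op (F.map f.op x) =
    F.map (World.extendMap L f).op (F.map (w.proj L).op x)
  simp only [← Functor.map_comp_apply, ← op_comp, World.extendMap_proj]

/-- Application of a rule of `B`. A natural transformation to the presheaf represented by
`(B, [])` witnesses that `B` is contained in the bases at which `F` is inhabited. -/
def applyRule {R : AtomicRule Atom} (hR : R ∈ B) (ν : F ⟶ yoneda.obj ⟨B, []⟩)
    (γ : ∀ i, FunctorToTypes.prod F (assumptions (R.prems.get i).1.toList) ⟶
      atom (R.prems.get i).2) : F ⟶ atom R.concl where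
  app w := TypeCat.ofHom fun x =>
    Der.app R ((show w.unop ⟶ ⟨B, []⟩ from ν.app w x).incl hR) fun i => premise (γ i) x
  naturality v w f := by
    ext x
    change Der.app R _ _ = Der.app R _ _
    congr 1
    funext i
    exact premise_map (γ i) f.unop x

end Rules

end Psh

section PresheafModel

/-- The presheaves as worlds of a Kripke model: `F ≤ G` if there is a natural
transformation `G ⟶ F`. -/
structure PshPreorder (Atom : Type u) : Type (u + 1) where
  psh : Psh Atom

instance : Preorder (PshPreorder Atom) where
  le F G := Nonempty (G.psh ⟶ F.psh)
  le_refl F := ⟨𝟙 F.psh⟩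
  le_trans _ _ _ := fun ⟨α⟩ ⟨β⟩ => ⟨β ≫ α⟩

/-- The presheaves that map to the presheaf of derivations of an atom. -/
def presheavesOver (p : Atom) : UpperSet (PshPreorder Atom) := .Ici ⟨Psh.atom p⟩

theorem forces_presheavesOver_iff {φ : Formula Atom} {F : PshPreorder Atom} :
    Forces presheavesOver φ F ↔ Nonempty (F.psh ⟶ sem φ) := by
  induction φ generalizing F with
  | atom p => rfl
  | bot => exact Psh.nonempty_hom_all_iff.symm
  | and φ ψ ihφ ihψ => rw [Forces, sem, Psh.nonempty_hom_prod_iff, ihφ, ihψ]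
  | imp φ ψ ihφ ihψ =>
    simp only [Forces, sem, Psh.nonempty_hom_exp_iff, ihφ, ihψ]
    exact ⟨fun h G => h ⟨G⟩, fun h G => h G.psh⟩
  | or φ ψ ihφ ihψ =>
    simp only [Forces, sem, Psh.nonempty_hom_all_iff, Psh.nonempty_hom_exp_iff, ihφ, ihψ]
    refine forall_congr' fun p => ⟨fun h G hG hφ G' hG' hψ => ?_, fun h G hG hφ hψ => ?_⟩
    · exact h ⟨G'⟩ (hG'.map2 (· ≫ ·) hG)
        (fun H hH => hφ H.psh (hH.map2 (· ≫ ·) hG')) fun H => hψ H.psh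
    · exact h G.psh hG (fun H => hφ ⟨H⟩) G.psh ⟨𝟙 _⟩ fun H => hψ ⟨H⟩

theorem catValid_iff_consequence {Γ : Finset (Formula Atom)} {φ : Formula Atom} :
    CatValid Γ φ ↔ Consequence presheavesOver Γ φ := by
  simp only [Consequence, forces_presheavesOver_iff]
  have hom_semCtx_iff {F : Psh Atom} :
      Nonempty (F ⟶ semCtx Γ) ↔ ∀ ψ ∈ Γ, Nonempty (F ⟶ sem ψ) :=
    Psh.nonempty_hom_pi_iff.trans Subtype.forall
  exact ⟨fun ⟨α⟩ F hF => (hom_semCtx_iff.2 hF).map (· ≫ α),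
    fun h => h ⟨semCtx Γ⟩ (hom_semCtx_iff.1 ⟨𝟙 _⟩)⟩

theorem isGeneric_presheavesOver : IsGeneric (presheavesOver (Atom := Atom)) := by
  refine fun B => ⟨⟨yoneda.obj ⟨B, []⟩⟩, fun R hR F hF hprems => ?_, fun P q h => ?_⟩
  · obtain ⟨ν⟩ := hF
    have premise_hom (i : Fin R.prems.length) :
        Nonempty (FunctorToTypes.prod F.psh (Psh.assumptions (R.prems.get i).1.toList) ⟶
          Psh.atom (R.prems.get i).2) := by
      refine hprems _ (List.get_mem R.prems i) ⟨_⟩ ⟨FunctorToTypes.prod.fst⟩ fun a ha => ?_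
      exact Psh.nonempty_hom_assumptions_iff.1 ⟨FunctorToTypes.prod.snd⟩ a (Finset.mem_toList.2 ha)
    exact ⟨Psh.applyRule hR ν fun i => (premise_hom i).some⟩
  · obtain ⟨α⟩ := h ⟨yoneda.obj ⟨B, P.toList⟩⟩
      ⟨yoneda.map ⟨subset_rfl, fun _ x => nomatch x⟩⟩ fun a ha =>
        (Var.nonempty_of_mem (Finset.mem_toList.2 ha)).map fun x => yonedaEquiv.symm (Der.var x)
    have Φ : Der B P.toList q := yonedaEquiv (F := Psh.atom q) α
    exact Φ.entails.mono subset_rfl fun a ha => by simpa using ha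

end PresheafModel

end

end BaseExt

theorem mainTheorem1 {Atom : Type*} [Infinite Atom] (Γ : Finset (BaseExt.Formula Atom))
    (φ : BaseExt.Formula Atom) : BaseExt.Valid Γ φ ↔ BaseExt.CatValid Γ φ := by
  rw [BaseExt.valid_iff_consequence, BaseExt.catValid_iff_consequence]
  exact ⟨BaseExt.isGeneric_basesDeriving.consequence, BaseExt.isGeneric_presheavesOver.consequence⟩
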